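/- Let $X$ be a compact metric space with Borel $\sigma$-algebra $\mathcal{B}$, let $\mu$ be a non-atomic Borel probability measure on $X$ (that is, $\mu(\{x\})=0$ for all $x\in X$), and let $T:X\to X$ be a measurable, $\mu$-preserving, ergodic map (not necessarily invertible). For $n\ge 1$ let $\Omega(n)$ be the number of prime factors of $n$ counted with multiplicity. For $A\in\mathcal{B}$ consider the property $$(\ast)\qquad \limsup_{N\to\infty}\frac1N\sum_{n=1}^N 1_A(T^{\Omega(n)}x)=1\quad\text{and}\quad \liminf_{N\to\infty}\frac1N\sum_{n=1}^N 1_A(T^{\Omega(n)}x)=0\quad\text{for $\mu$-almost every }x\in X.$$ Then: 1. There is a set $A\in\mathcal{B}$ satisfying $(\ast)$. 2. The operators $T^{\Omega(n)}$ have the strong sweeping-out property: there is a dense $G_\delta$ subset $\mathcal{R}\subseteq\mathcal{B}$, with respect to the pseudometric $d(A,B)=\mu(A\mathbin{\triangle}B)$ on $\mathcal{B}$, such that every $A\in\mathcal{R}$ satisfies $(\ast)$. 3. The pointwise ergodic theorem fails along $\Omega(n)$: there is $f\in L^1(\mu)$ such that for $\mu$-almost every $x\in X$ the averages $\frac1N\sum_{n=1}^N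 f(T^{\Omega(n)}x)$ do not converge to a real number as $N\to\infty$. -/

import Mathlib

open MeasureTheory Filter
open scoped Topology ArithmeticFunction.Omega

noncomputable section

/-- The averages `(1 / N) * ∑_{n = 1}^{N} f (τ n x)` of `f` along a sequence `τ` of self-maps. -/
def avgAlong {X : Type*} (τ : ℕ → X → X) (f : X → ℝ) (N : ℕ) (x : X) : ℝ :=
  (1 / (N : ℝ)) * ∑ n ∈ Finset.Icc 1 N, f (τ n x)

/-- The sequence of maps `n ↦ T ^ Ω(n)`, where `Ω n` is the number of prime factors of `n`
counted with multiplicity. -/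
def omegaIterate {X : Type*} (T : X → X) (n : ℕ) : X → X :=
  T^[Ω n]

/-- The averages along `τ` of the indicator function of `A` have upper limit `1` and lower limit
`0` at almost every point. All these averages lie in `[0, 1]`, so that the upper and lower limits
in `ℝ` are the usual ones. -/
def SweepsOut {X : Type*} [MeasurableSpace X] (μ : Measure X) (τ : ℕ → X → X) (A : Set X) : Prop :=
  ∀ᵐ x ∂μ,
    limsup (fun N : ℕ => avgAlong τ (A.indicator (fun _ => (1 : ℝ))) N x) atTop = 1 ∧
    liminf (fun N : ℕ => avgAlong τ (A.indicator (fun _ => (1 : ℝ))) N x) atTop = 0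

/-- The strong sweeping-out property: the sets that are swept out contain a dense `G_δ` subset
of the space `MeasuredSets μ` of all measurable sets, with the (pseudo-)distance
`d(A, B) = μ (A ∆ B)`. -/
def StrongSweepingOut {X : Type*} [MeasurableSpace X] (μ : Measure X) (τ : ℕ → X → X) : Prop :=
  ∃ R : Set (MeasuredSets μ), IsGδ R ∧ Dense R ∧ ∀ A ∈ R, SweepsOut μ τ (A : Set X)

end

/-! By Hardy–Ramanujan, for suitable `N` almost all `n ≤ N` have `Ω n` close to `m`, the rounded sum
of `1 / p` over primes `p ≤ N`, and `m` may be any large integer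
(`exists_cardFactors_concentrated`). The average up to `N` thus sees the orbit of `x` essentially
through one window of times around `m`, short compared with `m`.

Ergodicity gives a set `B` of measure at most `2 / L` that almost every orbit visits before time
`L`. The points reaching `B` within a small fraction of `L` steps form a set `E` of small measure,
yet an orbit stays in `E` throughout the window preceding a visit to `B`. Placing the
Hardy–Ramanujan window there makes an average of `1_E` nearly `1`
(`exists_small_set_largeAverageSet`). Only preimages are used, so `T` need not be invertible.

Baire category finishes: having a late average near `1` off a small set is an open condition on `A`,
and a dense one because `A ∪ E` is close to `A`. Complementation is a homeomorphism, which yields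
the lower limit `0`. A single generic indicator then refutes pointwise convergence. -/

/-! ### Concentration of the number of prime factors. -/

/-- The sum of the reciprocals of the primes up to `N`. -/
noncomputable def primeReciprocalSum (N : ℕ) : ℝ :=
  ∑ p ∈ (Finset.Ioc 0 N).filter Nat.Prime, (1 : ℝ) / p

lemma primeReciprocalSum_nonneg (N : ℕ) : 0 ≤ primeReciprocalSum N :=
  Finset.sum_nonneg fun _ _ => by positivity

lemma primeReciprocalSum_succ_le (N : ℕ) :
    primeReciprocalSum (N + 1) ≤ primeReciprocalSum N + 1 := by
  unfold primeReciprocalSum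
  rw [← Finset.insert_Ioc_right_eq_Ioc_add_one (Nat.zero_le N), Finset.filter_insert]
  split_ifs with h
  · rw [Finset.sum_insert (by simp)]
    have : (1 : ℝ) / ((N + 1 : ℕ) : ℝ) ≤ 1 := by
      rw [div_le_one (by positivity)]
      push_cast
      linarith [(Nat.cast_nonneg N : (0 : ℝ) ≤ N)]
    linarith
  · linarith

lemma primeReciprocalSum_le (N : ℕ) : primeReciprocalSum N ≤ N := by
  induction N with
  | zero => simp [primeReciprocalSum]
  | succ n ih =>
    push_cast
    linarith [primeReciprocalSum_succ_le n]

lemma exists_le_primeReciprocalSum (c : ℝ) : ∃ N, c ≤ primeReciprocalSum N := by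
  by_contra! h
  refine not_summable_one_div_on_primes (summable_of_sum_range_le (c := c) (fun n => ?_) fun n => ?_)
  · exact Set.indicator_nonneg (fun _ _ => by positivity) _
  · refine le_trans ?_ (h n).le
    unfold primeReciprocalSum
    rw [Finset.sum_filter]
    have hf : ∀ p : ℕ, Set.indicator {p : ℕ | p.Prime} (fun n : ℕ => (1 : ℝ) / n) p =
        if p.Prime then (1 : ℝ) / p else 0 := fun p => by simp [Set.indicator_apply]
    simp only [hf]
    have h0 : ∀ p ∈ Finset.range n, p ∉ Finset.Ioc 0 n →
        (if p.Prime then (1 : ℝ) / p else 0) = 0 := by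
      intro p hp hp'
      have : p = 0 := by simp at hp hp'; omega
      simp [this]
    rw [← Finset.sum_filter_add_sum_filter_not (Finset.range n) (· ∈ Finset.Ioc 0 n)]
    rw [Finset.sum_eq_zero (s := Finset.filter (fun x => x ∉ Finset.Ioc 0 n) _)
      (fun p hp => h0 p (Finset.mem_filter.1 hp).1 (Finset.mem_filter.1 hp).2), add_zero]
    exact Finset.sum_le_sum_of_subset_of_nonneg (fun p hp => (Finset.mem_filter.1 hp).2)
      fun p _ _ => by split_ifs <;> positivity

/-- The sums of reciprocals of primes come within distance `1` of each natural number. -/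
lemma exists_primeReciprocalSum_near (m : ℕ) (hm : 0 < m) :
    ∃ N, m ≤ N ∧ (m : ℝ) ≤ primeReciprocalSum N ∧ primeReciprocalSum N ≤ m + 1 := by
  classical
  have hex := exists_le_primeReciprocalSum (m : ℝ)
  have hspec := Nat.find_spec hex
  have hle : m ≤ Nat.find hex := by exact_mod_cast hspec.trans (primeReciprocalSum_le _)
  refine ⟨Nat.find hex, hle, hspec, ?_⟩
  obtain ⟨k, hk⟩ : ∃ k, Nat.find hex = k + 1 := ⟨Nat.find hex - 1, by omega⟩
  have hlt : primeReciprocalSum k < m := not_le.1 (Nat.find_min hex (by omega : k < Nat.find hex))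
  rw [hk]
  linarith [primeReciprocalSum_succ_le k]

lemma primeFactors_eq_filter_Ioc {n N : ℕ} (hn : n ∈ Finset.Ioc 0 N) :
    n.primeFactors = ((Finset.Ioc 0 N).filter Nat.Prime).filter (· ∣ n) := by
  ext p
  simp only [Finset.mem_Ioc] at hn
  simp only [Nat.mem_primeFactors, Finset.mem_filter, Finset.mem_Ioc]
  exact ⟨fun h => ⟨⟨⟨h.1.pos, (Nat.le_of_dvd hn.1 h.2.1).trans hn.2⟩, h.1⟩, h.2.1⟩,
    fun h => ⟨h.1.2, h.2, by omega⟩⟩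

lemma card_primeFactors_eq_sum {n N : ℕ} (hn : n ∈ Finset.Ioc 0 N) :
    (n.primeFactors.card : ℝ) =
      ∑ p ∈ (Finset.Ioc 0 N).filter Nat.Prime, if p ∣ n then (1 : ℝ) else 0 := by
  rw [primeFactors_eq_filter_Ioc hn, Finset.sum_boole]

lemma sum_ite_dvd (N d : ℕ) :
    ∑ n ∈ Finset.Ioc 0 N, (if d ∣ n then (1 : ℝ) else 0) = ((N / d : ℕ) : ℝ) := by
  rw [Finset.sum_boole, Nat.Ioc_filter_dvd_card_eq_div]

/-- Counting multiples of each prime, the floor in `N / p` loses at most `1`, and there are at most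
`N` primes. -/
lemma le_sum_card_primeFactors (N : ℕ) :
    N * primeReciprocalSum N - N ≤ ∑ n ∈ Finset.Ioc 0 N, (n.primeFactors.card : ℝ) := by
  rw [Finset.sum_congr rfl fun n hn => card_primeFactors_eq_sum hn, Finset.sum_comm]
  simp only [sum_ite_dvd]
  have h1 : ∑ p ∈ (Finset.Ioc 0 N).filter Nat.Prime, ((N : ℝ) * (1 / p) - 1) ≤
      ∑ p ∈ (Finset.Ioc 0 N).filter Nat.Prime, ((N / p : ℕ) : ℝ) := by
    refine Finset.sum_le_sum fun p hp => ?_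
    have := Nat.lt_floor_add_one ((N : ℝ) / p)
    rw [Nat.floor_div_eq_div] at this
    rw [mul_one_div]
    linarith
  rw [Finset.sum_sub_distrib, ← Finset.mul_sum] at h1
  have h2 : ((((Finset.Ioc 0 N).filter Nat.Prime).card : ℕ) : ℝ) ≤ N := by
    exact_mod_cast (Finset.card_filter_le _ _).trans (by simp)
  simp only [Finset.sum_const, nsmul_eq_mul, mul_one] at h1
  unfold primeReciprocalSum
  linarith

/-- Expand the square over pairs of primes. Distinct primes are coprime, so the pair contributes at
most `N / (p * q)`; the diagonal gives the linear term. -/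
lemma sum_card_primeFactors_sq_le (N : ℕ) :
    ∑ n ∈ Finset.Ioc 0 N, (n.primeFactors.card : ℝ) ^ 2 ≤
      N * primeReciprocalSum N ^ 2 + N * primeReciprocalSum N := by
  have h1 : ∑ n ∈ Finset.Ioc 0 N, (n.primeFactors.card : ℝ) ^ 2 =
      ∑ p ∈ (Finset.Ioc 0 N).filter Nat.Prime, ∑ q ∈ (Finset.Ioc 0 N).filter Nat.Prime,
        ∑ n ∈ Finset.Ioc 0 N,
          ((if p ∣ n then (1 : ℝ) else 0) * (if q ∣ n then (1 : ℝ) else 0)) := by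
    rw [Finset.sum_congr rfl fun n hn => by
      rw [card_primeFactors_eq_sum hn, sq, Finset.sum_mul_sum], Finset.sum_comm]
    exact Finset.sum_congr rfl fun p _ => Finset.sum_comm
  have h2 : ∀ p ∈ (Finset.Ioc 0 N).filter Nat.Prime, ∀ q ∈ (Finset.Ioc 0 N).filter Nat.Prime,
      ∑ n ∈ Finset.Ioc 0 N,
          ((if p ∣ n then (1 : ℝ) else 0) * (if q ∣ n then (1 : ℝ) else 0)) ≤
        N * ((1 / p : ℝ) * (1 / q)) + if p = q then N * (1 / p : ℝ) else 0 := by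
    intro p hp q hq
    have hp' := (Finset.mem_filter.1 hp).2
    have hq' := (Finset.mem_filter.1 hq).2
    by_cases hpq : p = q
    · subst hpq
      simp only [mul_ite, mul_one, mul_zero, if_true]
      have h3 : ∑ n ∈ Finset.Ioc 0 N, (if p ∣ n then (if p ∣ n then (1 : ℝ) else 0) else 0) =
          ((N / p : ℕ) : ℝ) := by
        rw [← sum_ite_dvd]
        exact Finset.sum_congr rfl fun n _ => by split_ifs <;> rfl
      rw [h3]
      have : ((N / p : ℕ) : ℝ) ≤ N * (1 / p) := by rw [mul_one_div]; exact Nat.cast_div_le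
      have : (0 : ℝ) ≤ N * ((1 / p : ℝ) * (1 / p)) := by positivity
      linarith
    · have hc := (Nat.coprime_primes hp' hq').2 hpq
      have h3 : ∑ n ∈ Finset.Ioc 0 N,
          ((if p ∣ n then (1 : ℝ) else 0) * (if q ∣ n then (1 : ℝ) else 0)) =
          ((N / (p * q) : ℕ) : ℝ) := by
        rw [← sum_ite_dvd]
        refine Finset.sum_congr rfl fun n _ => ?_
        have : p * q ∣ n ↔ p ∣ n ∧ q ∣ n :=
          ⟨fun h => ⟨dvd_of_mul_right_dvd h, dvd_of_mul_left_dvd h⟩,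
            fun h => hc.mul_dvd_of_dvd_of_dvd h.1 h.2⟩
        by_cases h1 : p ∣ n <;> by_cases h2 : q ∣ n <;> simp [this, h1, h2]
      rw [h3, if_neg hpq, add_zero, one_div_mul_one_div, mul_one_div]
      exact_mod_cast (Nat.cast_div_le : ((N / (p * q) : ℕ) : ℝ) ≤ _)
  rw [h1]
  refine (Finset.sum_le_sum fun p hp => Finset.sum_le_sum fun q hq => h2 p hp q hq).trans
    (le_of_eq ?_)
  simp only [Finset.sum_add_distrib]
  congr 1
  · simp only [← Finset.mul_sum]
    rw [← Finset.sum_mul, sq]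
    rfl
  · rw [primeReciprocalSum, Finset.mul_sum]
    refine Finset.sum_congr rfl fun p hp => ?_
    rw [Finset.sum_ite_eq, if_pos hp]

/-- **Turán's inequality** for the number of distinct prime factors. -/
lemma sum_card_primeFactors_sub_sq_le (N : ℕ) :
    ∑ n ∈ Finset.Ioc 0 N, ((n.primeFactors.card : ℝ) - primeReciprocalSum N) ^ 2 ≤
      3 * N * primeReciprocalSum N := by
  set M := primeReciprocalSum N with hM
  have h0 : 0 ≤ M := primeReciprocalSum_nonneg N
  have h1 := le_sum_card_primeFactors N
  have h2 := sum_card_primeFactors_sq_le N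
  have h3 : ∑ n ∈ Finset.Ioc 0 N, ((n.primeFactors.card : ℝ) - M) ^ 2 =
      ∑ n ∈ Finset.Ioc 0 N, (n.primeFactors.card : ℝ) ^ 2 -
        2 * M * ∑ n ∈ Finset.Ioc 0 N, (n.primeFactors.card : ℝ) + N * M ^ 2 := by
    rw [Finset.mul_sum, ← Finset.sum_sub_distrib]
    have : (N : ℝ) * M ^ 2 = ∑ n ∈ Finset.Ioc 0 N, M ^ 2 := by simp
    rw [this, ← Finset.sum_add_distrib]
    exact Finset.sum_congr rfl fun n _ => by ring
  rw [← hM] at h1 h2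
  rw [h3]
  nlinarith [mul_le_mul_of_nonneg_left h1 h0]

lemma sum_cardFactors_eq (N : ℕ) : ∑ n ∈ Finset.Ioc 0 N, Ω n = Ω N.factorial := by
  induction N with
  | zero => simp
  | succ n ih =>
    rw [← Finset.insert_Ioc_right_eq_Ioc_add_one (Nat.zero_le n), Finset.sum_insert (by simp), ih,
      Nat.factorial_succ, ArithmeticFunction.cardFactors_mul (by omega) (Nat.factorial_ne_zero n)]

lemma sum_Ioc_one_div_sub_one_sub_le (N : ℕ) :
    ∑ k ∈ Finset.Ioc 1 N, (1 / ((k : ℝ) - 1) - 1 / k) ≤ 1 := by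
  rcases Nat.eq_zero_or_pos N with rfl | hN
  · simp
  have h : ∑ k ∈ Finset.Ioc 1 N, (1 / ((k : ℝ) - 1) - 1 / k) = 1 - 1 / N := by
    induction N, hN using Nat.le_induction with
    | base => simp
    | succ n hn ih =>
      rw [← Finset.insert_Ioc_right_eq_Ioc_add_one hn, Finset.sum_insert (by simp), ih]
      push_cast
      ring
  rw [h]
  have : (0 : ℝ) ≤ 1 / N := by positivity
  linarith

/-- The sum is `Ω (N!)`, and Legendre's formula bounds the exponent of `p` in `N!` by `N / (p - 1)`.
Replacing `p - 1` by `p` costs a telescoping sum. With `le_sum_card_primeFactors` this shows that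
multiplicities contribute at most `2 * N` in total. -/
lemma sum_cardFactors_le (N : ℕ) :
    ∑ n ∈ Finset.Ioc 0 N, (Ω n : ℝ) ≤ N * primeReciprocalSum N + N := by
  have h1 : ∑ n ∈ Finset.Ioc 0 N, (Ω n : ℝ) = (Ω N.factorial : ℝ) := by
    exact_mod_cast sum_cardFactors_eq N
  have hsub : N.factorial.primeFactors ⊆ (Finset.Ioc 0 N).filter Nat.Prime := by
    intro p hp
    have hp' := Nat.prime_of_mem_primeFactors hp
    simp only [Finset.mem_filter, Finset.mem_Ioc]
    exact ⟨⟨hp'.pos, (hp'.dvd_factorial).1 (Nat.dvd_of_mem_primeFactors hp)⟩, hp'⟩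
  have hv : ∀ p ∈ (Finset.Ioc 0 N).filter Nat.Prime,
      (N.factorial.factorization p : ℝ) ≤ N * (1 / p) + N * (1 / ((p : ℝ) - 1) - 1 / p) := by
    intro p hp
    have hp' := (Finset.mem_filter.1 hp).2
    have := Fact.mk hp'
    have h2 : (p - 1) * padicValNat p N.factorial ≤ N := by
      rw [sub_one_mul_padicValNat_factorial]; exact Nat.sub_le _ _
    have h3 : ((p : ℝ) - 1) * (padicValNat p N.factorial : ℝ) ≤ N := by
      have : (((p - 1 : ℕ) : ℝ)) * (padicValNat p N.factorial : ℝ) ≤ N := by exact_mod_cast h2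
      rwa [Nat.cast_sub hp'.one_le, Nat.cast_one] at this
    have hp1 : (0 : ℝ) < (p : ℝ) - 1 := by
      have : (1 : ℝ) < p := by exact_mod_cast hp'.one_lt
      linarith
    rw [Nat.factorization_def _ hp']
    have : (padicValNat p N.factorial : ℝ) ≤ N * (1 / ((p : ℝ) - 1)) := by
      rw [mul_one_div, le_div_iff₀ hp1]
      linarith
    linarith
  rw [h1, ArithmeticFunction.cardFactors_eq_sum_factorization, Finsupp.sum,
    Nat.support_factorization]
  push_cast
  calc ∑ p ∈ N.factorial.primeFactors, (N.factorial.factorization p : ℝ)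
      ≤ ∑ p ∈ (Finset.Ioc 0 N).filter Nat.Prime, (N.factorial.factorization p : ℝ) :=
        Finset.sum_le_sum_of_subset_of_nonneg hsub fun _ _ _ => by positivity
    _ ≤ _ := Finset.sum_le_sum hv
    _ = N * primeReciprocalSum N +
        N * ∑ p ∈ (Finset.Ioc 0 N).filter Nat.Prime, (1 / ((p : ℝ) - 1) - 1 / p) := by
      rw [Finset.sum_add_distrib, ← Finset.mul_sum, ← Finset.mul_sum]; rfl
    _ ≤ N * primeReciprocalSum N + N * 1 := by
      gcongr
      refine le_trans ?_ (sum_Ioc_one_div_sub_one_sub_le N)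
      refine Finset.sum_le_sum_of_subset_of_nonneg (fun p hp => ?_) fun k hk _ => ?_
      · simp only [Finset.mem_filter, Finset.mem_Ioc] at hp ⊢
        exact ⟨hp.2.one_lt, hp.1.2⟩
      · have : (1 : ℝ) < k := by exact_mod_cast (Finset.mem_Ioc.1 hk).1
        exact sub_nonneg.2 (one_div_le_one_div_of_le (by linarith) (by linarith))
    _ = _ := by ring

lemma card_primeFactors_le_cardFactors (n : ℕ) : n.primeFactors.card ≤ Ω n := by
  rw [ArithmeticFunction.cardFactors_apply]
  exact List.toFinset_card_le _

/-- A form of the Hardy–Ramanujan theorem: there are arbitrarily long ranges `[1, N]` on which the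
values of `Ω` concentrate near any prescribed large number `m`. -/
lemma exists_cardFactors_concentrated {ε η : ℝ} (hε : 0 < ε) (hη : 0 < η) (N₀ : ℕ) :
    ∃ m₀ : ℕ, ∀ m ≥ m₀, ∃ N ≥ N₀, 0 < N ∧
      (((Finset.Icc 1 N).filter fun n => η * m < |(Ω n : ℝ) - m|).card : ℝ) ≤ ε * N := by
  -- With `t = η * m / 3`, the first bound gives `t ≥ 1`; the second makes the final estimate `2 * N
  -- / t + 6 * N * m / t ^ 2` at most `ε * N`.
  obtain ⟨m₁, hm₁⟩ := exists_nat_ge (max (3 / η) ((6 / η + 54 / η ^ 2) / ε))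
  refine ⟨max (max N₀ 1) m₁, fun m hm => ?_⟩
  have hm1 : 1 ≤ m := by omega
  have hmr : (1 : ℝ) ≤ m := by exact_mod_cast hm1
  have hmm : (m₁ : ℝ) ≤ m := by exact_mod_cast (le_max_right _ _).trans hm
  obtain ⟨N, hN, hlo, hhi⟩ := exists_primeReciprocalSum_near m hm1
  refine ⟨N, by omega, by omega, ?_⟩
  have hηm : 3 ≤ η * m := by
    have := (le_max_left _ _).trans (hm₁.trans hmm)
    rwa [div_le_iff₀' hη] at this
  have hεm : 6 / η + 54 / η ^ 2 ≤ ε * m := by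
    have := (le_max_right _ _).trans (hm₁.trans hmm)
    rwa [div_le_iff₀' hε] at this
  set M := primeReciprocalSum N with hM
  set t := η * m / 3 with ht
  have ht1 : 1 ≤ t := by rw [ht]; linarith
  -- Since `|M - m| ≤ 1 ≤ t`, a deviation above `3 * t` forces many repeated factors or a large
  -- deviation of the number of distinct ones: Markov for the former, Chebyshev for the latter.
  have hpt : ∀ n : ℕ, (if η * m < |(Ω n : ℝ) - m| then (1 : ℝ) else 0) ≤
      ((Ω n : ℝ) - n.primeFactors.card) / t + ((n.primeFactors.card : ℝ) - M) ^ 2 / t ^ 2 := by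
    intro n
    have hge : (n.primeFactors.card : ℝ) ≤ Ω n := by
      exact_mod_cast card_primeFactors_le_cardFactors n
    have ha : 0 ≤ ((Ω n : ℝ) - n.primeFactors.card) / t := div_nonneg (by linarith) (by linarith)
    have hb : 0 ≤ ((n.primeFactors.card : ℝ) - M) ^ 2 / t ^ 2 := by positivity
    split_ifs with h
    · by_cases h1 : t ≤ (Ω n : ℝ) - n.primeFactors.card
      · have := (one_le_div (by linarith : 0 < t)).2 h1
        linarith
      · have h2 : t ≤ |(n.primeFactors.card : ℝ) - M| := by
          have h3 : η * m = 3 * t := by rw [ht]; ring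
          rw [h3] at h
          by_contra! h4
          rw [abs_lt] at h4
          rw [lt_abs] at h
          rcases h with h | h <;> linarith
        have h3 : t ^ 2 ≤ ((n.primeFactors.card : ℝ) - M) ^ 2 := by
          rw [← sq_abs ((n.primeFactors.card : ℝ) - M)]
          exact pow_le_pow_left₀ (by linarith) h2 2
        have := (one_le_div (by positivity : 0 < t ^ 2)).2 h3
        linarith
    · linarith
  have hN0 : (0 : ℝ) ≤ N := Nat.cast_nonneg N
  have hsum1 : ∑ n ∈ Finset.Ioc 0 N, ((Ω n : ℝ) - n.primeFactors.card) ≤ 2 * N := by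
    rw [Finset.sum_sub_distrib]
    linarith [sum_cardFactors_le N, le_sum_card_primeFactors N]
  have hsum2 := sum_card_primeFactors_sub_sq_le N
  rw [← hM] at hsum2
  rw [← Finset.sum_boole, show Finset.Icc 1 N = Finset.Ioc 0 N from rfl]
  calc _ ≤ ∑ n ∈ Finset.Ioc 0 N, (((Ω n : ℝ) - n.primeFactors.card) / t +
        ((n.primeFactors.card : ℝ) - M) ^ 2 / t ^ 2) := Finset.sum_le_sum fun n _ => hpt n
    _ ≤ 2 * N / t + 3 * N * M / t ^ 2 := by
      rw [Finset.sum_add_distrib, ← Finset.sum_div, ← Finset.sum_div]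
      gcongr
    _ ≤ 2 * N / t + 3 * N * (2 * m) / t ^ 2 := by
      gcongr
      linarith
    _ = (6 / η + 54 / η ^ 2) / m * N := by
      rw [ht]
      field_simp
      ring
    _ ≤ ε * N := by
      gcongr
      rw [div_le_iff₀ (by linarith)]
      exact hεm

/-! ### Hitting times and small sets with large averages. -/

section Towers

variable {X : Type*} {T : X → X}

/-- The points whose orbit visits `F` for the first time at time `n`. -/
def firstHit (T : X → X) (F : Set X) (n : ℕ) : Set X :=
  {x | T^[n] x ∈ F ∧ ∀ i < n, T^[i] x ∉ F}

lemma firstHit_unique {F : Set X} {m n : ℕ} {x : X} (hm : x ∈ firstHit T F m)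
    (hn : x ∈ firstHit T F n) : m = n := by
  rcases lt_trichotomy m n with h | h | h
  · exact absurd hm.1 (hn.2 m h)
  · exact h
  · exact absurd hn.1 (hm.2 n h)

lemma firstHit_iterate {F : Set X} {n d : ℕ} {x : X} (hx : x ∈ firstHit T F n) (hd : d ≤ n) :
    T^[d] x ∈ firstHit T F (n - d) := by
  refine ⟨?_, fun i hi => ?_⟩
  · rw [← Function.iterate_add_apply, Nat.sub_add_cancel hd]
    exact hx.1
  · rw [← Function.iterate_add_apply]
    exact hx.2 _ (by omega)

/-- The points at which some average of `1_A` over at least `k` terms is at least `1 - δ`. -/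
def largeAverageSet (T : X → X) (A : Set X) (k : ℕ) (δ : ℝ) : Set X :=
  {x | ∃ N ≥ k, 1 - δ ≤ avgAlong (omegaIterate T) (A.indicator fun _ => (1 : ℝ)) N x}

lemma le_avgAlong_of_card_le {A : Set X} {ε : ℝ} {N : ℕ} (hN : 0 < N) {x : X} {S : Finset ℕ}
    (hS : ∀ n ∈ Finset.Icc 1 N, n ∉ S → T^[Ω n] x ∈ A) (hcard : (S.card : ℝ) ≤ ε * N) :
    1 - ε ≤ avgAlong (omegaIterate T) (A.indicator fun _ => (1 : ℝ)) N x := by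
  have hN' : (0 : ℝ) < N := by exact_mod_cast hN
  have h1 : ∑ n ∈ Finset.Icc 1 N, (1 - if n ∈ S then (1 : ℝ) else 0) ≤
      ∑ n ∈ Finset.Icc 1 N, A.indicator (fun _ => (1 : ℝ)) (omegaIterate T n x) := by
    refine Finset.sum_le_sum fun n hn => ?_
    split_ifs with h
    · simpa using Set.indicator_nonneg (fun _ _ => zero_le_one) _
    · rw [omegaIterate, Set.indicator_of_mem (hS n hn h)]
      simp
  have h2 : ∑ n ∈ Finset.Icc 1 N, (if n ∈ S then (1 : ℝ) else 0) ≤ S.card := by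
    rw [Finset.sum_boole]
    exact_mod_cast Finset.card_le_card fun n hn => (Finset.mem_filter.1 hn).2
  rw [Finset.sum_sub_distrib] at h1
  simp only [Finset.sum_const, Nat.card_Icc, add_tsub_cancel_right, nsmul_eq_mul, mul_one] at h1
  rw [avgAlong, one_div, ← div_eq_inv_mul, le_div_iff₀ hN']
  linarith

variable [MeasurableSpace X] {μ : Measure X}

lemma measurableSet_firstHit (hT : Measurable T) {F : Set X} (hF : MeasurableSet F) (n : ℕ) :
    MeasurableSet (firstHit T F n) := by
  have : firstHit T F n = T^[n] ⁻¹' F ∩ ⋂ i ∈ Finset.range n, (T^[i] ⁻¹' F)ᶜ := by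
    ext x
    simp [firstHit]
  rw [this]
  exact (hT.iterate n hF).inter
    (Finset.measurableSet_biInter _ fun i _ => (hT.iterate i hF).compl)

/-- The set of points that ever visit `F` contains its own preimage, hence is null or conull; it
contains `F`. -/
lemma ae_exists_firstHit [IsProbabilityMeasure μ] (hT : Ergodic T μ) {F : Set X}
    (hF : MeasurableSet F) (hF0 : μ F ≠ 0) : ∀ᵐ x ∂μ, ∃ n, x ∈ firstHit T F n := by
  classical
  have hG : MeasurableSet (⋃ n : ℕ, T^[n] ⁻¹' F) :=
    MeasurableSet.iUnion fun n => hT.measurable.iterate n hF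
  have hsub : T ⁻¹' (⋃ n : ℕ, T^[n] ⁻¹' F) ⊆ ⋃ n : ℕ, T^[n] ⁻¹' F := by
    intro x hx
    simp only [Set.mem_preimage, Set.mem_iUnion] at hx ⊢
    obtain ⟨n, hn⟩ := hx
    exact ⟨n + 1, hn⟩
  have hall : ∀ᵐ x ∂μ, x ∈ ⋃ n : ℕ, T^[n] ⁻¹' F := by
    rcases hT.ae_empty_or_univ_of_preimage_ae_le hG.nullMeasurableSet hsub.eventuallyLE with h | h
    · have h0 : μ (⋃ n : ℕ, T^[n] ⁻¹' F) = 0 := ae_eq_empty.1 h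
      exact absurd (measure_mono_null (Set.subset_iUnion (fun n : ℕ => T^[n] ⁻¹' F) 0) h0) hF0
    · filter_upwards [h.mem_iff] with x hx
      exact hx.2 trivial
  filter_upwards [hall] with x hx
  have hex : ∃ n, T^[n] x ∈ F := by simpa using hx
  exact ⟨Nat.find hex, Nat.find_spec hex, fun i hi => Nat.find_min hex hi⟩

/-- A set of measure at most `2 / L` that almost every orbit visits before time `L`. -/
lemma exists_small_set_visited_before [IsProbabilityMeasure μ] (hT : Ergodic T μ)
    (hsmall : ∀ δ : ℝ, 0 < δ → ∃ F, MeasurableSet F ∧ μ F ≠ 0 ∧ μ.real F ≤ δ)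
    {L : ℕ} (hL : 0 < L) :
    ∃ B, MeasurableSet B ∧ μ.real B ≤ 2 / L ∧ ∀ᵐ x ∂μ, ∃ j < L, T^[j] x ∈ B := by
  have hLr : (0 : ℝ) < L := by exact_mod_cast hL
  obtain ⟨F, hF, hF0, hFL⟩ := hsmall (1 / L) (by positivity)
  have hH := measurableSet_firstHit hT.measurable hF
  have hmeas : MeasurableSet (⋃ q : ℕ, firstHit T F ((q + 1) * L)) :=
    MeasurableSet.iUnion fun q => hH _
  -- The hitting time drops by one per step until `F` is reached. Here it is at least `L`, so it
  -- cannot be a positive multiple of `L` at two times less than `L` apart. The multiple `0` is left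
  -- out, since hitting times restart after `F`; `F` itself is small by choice.
  have hdisj : Set.PairwiseDisjoint (↑(Finset.range L))
      fun j => T^[j] ⁻¹' (⋃ q : ℕ, firstHit T F ((q + 1) * L)) := by
    have key : ∀ i j : ℕ, i < j → j < L → ∀ x,
        T^[i] x ∈ (⋃ q : ℕ, firstHit T F ((q + 1) * L)) →
        T^[j] x ∈ (⋃ q : ℕ, firstHit T F ((q + 1) * L)) → False := by
      intro i j hij hj x hi hj'
      simp only [Set.mem_iUnion] at hi hj'
      obtain ⟨q, hq⟩ := hi
      obtain ⟨q', hq'⟩ := hj'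
      have hle : L ≤ (q + 1) * L := Nat.le_mul_of_pos_left _ (Nat.succ_pos q)
      have h1 := firstHit_iterate hq (d := j - i) (by omega)
      rw [← Function.iterate_add_apply, Nat.sub_add_cancel hij.le] at h1
      have h2 := firstHit_unique h1 hq'
      have h3 : L ∣ j - i := by
        have h4 : j - i = (q + 1) * L - (q' + 1) * L := by omega
        rw [h4]
        exact Nat.dvd_sub (Dvd.intro_left _ rfl) (Dvd.intro_left _ rfl)
      have := Nat.le_of_dvd (by omega) h3
      omega
    intro i hi j hj hij
    simp only [Finset.coe_range, Set.mem_Iio] at hi hj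
    refine Set.disjoint_left.2 fun x hx hx' => ?_
    rcases lt_or_gt_of_ne hij with h | h
    · exact key i j h hj x hx hx'
    · exact key j i h hi x hx' hx
  have hB' : μ.real (⋃ q : ℕ, firstHit T F ((q + 1) * L)) ≤ 1 / L := by
    have h1 := measureReal_biUnion_finset (μ := μ) hdisj
      fun j _ => hT.measurable.iterate j hmeas
    have h2 : ∀ j : ℕ, μ.real (T^[j] ⁻¹' (⋃ q : ℕ, firstHit T F ((q + 1) * L))) =
        μ.real (⋃ q : ℕ, firstHit T F ((q + 1) * L)) := fun j =>
      (hT.toMeasurePreserving.iterate j).measureReal_preimage hmeas.nullMeasurableSet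
    simp only [h2, Finset.sum_const, Finset.card_range, nsmul_eq_mul] at h1
    rw [le_div_iff₀' hLr, ← h1]
    exact measureReal_le_one
  refine ⟨F ∪ ⋃ q : ℕ, firstHit T F ((q + 1) * L), hF.union hmeas, ?_, ?_⟩
  · refine (measureReal_union_le _ _).trans ?_
    have : (2 : ℝ) / L = 1 / L + 1 / L := by ring
    linarith
  · filter_upwards [ae_exists_firstHit hT hF hF0] with x ⟨n, hn⟩
    refine ⟨n % L, Nat.mod_lt _ hL, ?_⟩
    have h1 := firstHit_iterate hn (Nat.mod_le n L)
    have h2 : n - n % L = (n / L) * L := by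
      have := Nat.div_add_mod' n L
      omega
    rw [h2] at h1
    rcases Nat.eq_zero_or_pos (n / L) with h0 | h0
    · left
      rw [h0] at h1
      simpa using h1.1
    · right
      obtain ⟨q, hq⟩ : ∃ q, n / L = q + 1 := ⟨n / L - 1, by omega⟩
      rw [hq] at h1
      exact Set.mem_iUnion.2 ⟨q, h1⟩

/-- Small sets whose averages are nevertheless large somewhere along almost every orbit. -/
lemma exists_small_set_largeAverageSet [IsProbabilityMeasure μ] (hT : Ergodic T μ)
    (hsmall : ∀ δ : ℝ, 0 < δ → ∃ F, MeasurableSet F ∧ μ F ≠ 0 ∧ μ.real F ≤ δ)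
    {ε : ℝ} (hε : 0 < ε) (k : ℕ) :
    ∃ E, MeasurableSet E ∧ μ.real E ≤ ε ∧ μ.real (largeAverageSet T E k ε)ᶜ ≤ ε := by
  obtain ⟨m₀, hm₀⟩ := exists_cardFactors_concentrated hε (by positivity : 0 < ε / 8) k
  -- Large enough that both `(2 * r + 1) * (2 / L)` and `(m₀ + r) * (2 / L)` are at most `ε`, for
  -- `r` about `ε * L / 8`.
  obtain ⟨L, hLlarge⟩ := exists_nat_ge ((12 + 4 * (m₀ + 2)) / ε)
  have hL' : 12 + 4 * ((m₀ : ℝ) + 2) ≤ ε * L := by rwa [div_le_iff₀' hε] at hLlarge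
  have hLr : (0 : ℝ) < L := by
    by_contra! h
    have : (0 : ℝ) ≤ m₀ := Nat.cast_nonneg _
    nlinarith
  have hL : 0 < L := by exact_mod_cast hLr
  obtain ⟨B, hB, hBL, hvisit⟩ := exists_small_set_visited_before hT hsmall hL
  set r := ⌈ε / 8 * L⌉₊ with hr
  have hr1 : ε / 8 * L ≤ r := Nat.le_ceil _
  have hr2 : (r : ℝ) < ε / 8 * L + 1 := Nat.ceil_lt_add_one (by positivity)
  have hunion : ∀ s : ℕ, μ.real (⋃ i ∈ Finset.range s, T^[i] ⁻¹' B) ≤ s * (2 / L) := by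
    intro s
    refine (measureReal_biUnion_finset_le _ _).trans ?_
    have h2 : ∀ j : ℕ, μ.real (T^[j] ⁻¹' B) = μ.real B := fun j =>
      (hT.toMeasurePreserving.iterate j).measureReal_preimage hB.nullMeasurableSet
    simp only [h2, Finset.sum_const, Finset.card_range, nsmul_eq_mul]
    gcongr
  refine ⟨⋃ i ∈ Finset.range (2 * r + 1), T^[i] ⁻¹' B,
    Finset.measurableSet_biUnion _ fun i _ => hT.measurable.iterate i hB, ?_, ?_⟩
  · refine (hunion _).trans ?_
    rw [mul_div_assoc', div_le_iff₀ hLr]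
    push_cast
    have : (0 : ℝ) ≤ m₀ := Nat.cast_nonneg _
    linarith
  · have hsub : (largeAverageSet T (⋃ i ∈ Finset.range (2 * r + 1), T^[i] ⁻¹' B) k ε)ᶜ ⊆
        {x | ¬ ∃ j < L, T^[j] x ∈ B} ∪ ⋃ i ∈ Finset.range (m₀ + r), T^[i] ⁻¹' B := by
      intro x hx
      by_contra hx'
      simp only [Set.mem_union, Set.mem_ofPred_eq, not_or, not_not] at hx'
      obtain ⟨⟨j, hjL, hj⟩, hnot⟩ := hx'
      have hjge : m₀ + r ≤ j := by
        by_contra! h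
        exact hnot (Set.mem_biUnion (Finset.mem_coe.2 (Finset.mem_range.2 h)) hj)
      -- Centring at `j - r` puts most values `Ω n` between `j - 2 * r` and `j`; from such a time
      -- the visit to `B` at time `j` is at most `2 * r` steps ahead.
      obtain ⟨N, hNk, hN, hcard⟩ := hm₀ (j - r) (by omega)
      refine hx ⟨N, hNk, le_avgAlong_of_card_le hN (fun n hn hnS => ?_) hcard⟩
      have habs : |(Ω n : ℝ) - (j - r : ℕ)| ≤ r := by
        have h1 : ¬ ε / 8 * ((j - r : ℕ) : ℝ) < |(Ω n : ℝ) - (j - r : ℕ)| :=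
          fun h => hnS (Finset.mem_filter.2 ⟨hn, h⟩)
        have h2 : ((j - r : ℕ) : ℝ) ≤ L := by exact_mod_cast (by omega : j - r ≤ L)
        have h3 : ε / 8 * ((j - r : ℕ) : ℝ) ≤ ε / 8 * L := by gcongr
        linarith
      have hup : Ω n ≤ j := by
        have h1 : (Ω n : ℝ) ≤ ((j - r : ℕ) : ℝ) + r := by linarith [(abs_le.1 habs).2]
        have h2 : Ω n ≤ j - r + r := by exact_mod_cast h1
        omega
      have hlow : j ≤ Ω n + 2 * r := by
        have h1 : ((j - r : ℕ) : ℝ) ≤ (Ω n : ℝ) + r := by linarith [(abs_le.1 habs).1]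
        have h2 : j - r ≤ Ω n + r := by exact_mod_cast h1
        omega
      refine Set.mem_biUnion (x := j - Ω n)
        (Finset.mem_coe.2 (Finset.mem_range.2 (by omega))) ?_
      rw [Set.mem_preimage, ← Function.iterate_add_apply, Nat.sub_add_cancel hup]
      exact hj
    have hnull : μ.real {x | ¬ ∃ j < L, T^[j] x ∈ B} = 0 := by
      rw [measureReal_def, ae_iff.1 hvisit, ENNReal.toReal_zero]
    refine (measureReal_mono hsub).trans ((measureReal_union_le _ _).trans ?_)
    rw [hnull, zero_add]
    refine (hunion _).trans ?_
    rw [mul_div_assoc', div_le_iff₀ hLr]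
    push_cast
    linarith

end Towers

/-- Some point has only neighbourhoods of positive measure; being null, it has open neighbourhoods
of arbitrarily small measure. -/
lemma exists_measurableSet_small_measure {X : Type*} [MetricSpace X] [CompactSpace X]
    [MeasurableSpace X] [BorelSpace X] (μ : Measure X) [IsProbabilityMeasure μ]
    [NullSingletonClass μ] (δ : ℝ) (hδ : 0 < δ) :
    ∃ F, MeasurableSet F ∧ μ F ≠ 0 ∧ μ.real F ≤ δ := by
  obtain ⟨x, -, hx⟩ := exists_mem_forall_mem_nhdsWithin_pos_measure (μ := μ) (s := Set.univ)
    (by simp)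
  obtain ⟨U, hxU, hU, hlt⟩ := Set.exists_isOpen_lt_of_lt {x} (ENNReal.ofReal δ)
    (by simpa using hδ : μ {x} < ENNReal.ofReal δ)
  refine ⟨U, hU.measurableSet, (hx U ?_).ne', ENNReal.toReal_le_of_le_ofReal hδ.le hlt.le⟩
  rw [nhdsWithin_univ]
  exact hU.mem_nhds (hxU rfl)

/-! ### Completeness of the space of measurable sets. -/

section MeasuredSetsTopology

open scoped symmDiff ENNReal

variable {X : Type*} [MeasurableSpace X] {μ : Measure X}

/-- A measurable set, as an element of `MeasuredSets μ`. -/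
def toMeasuredSets (μ : Measure X) (A : Set X) (hA : MeasurableSet A) : MeasuredSets μ :=
  ⟨A, hA⟩

lemma coe_toMeasuredSets {A : Set X} (hA : MeasurableSet A) :
    (toMeasuredSets μ A hA : Set X) = A := rfl

/-- Needed for Baire's theorem. The limit is the set-theoretic limsup: a point where it differs from
`u n` must change membership at some later step, and those changes have geometrically small measure.
-/
instance completeSpace_measuredSets : CompleteSpace (MeasuredSets μ) := by
  refine EMetric.complete_of_convergent_controlled_sequences (fun n => (2⁻¹ : ℝ≥0∞) ^ n)
    (fun n => ENNReal.pow_pos (by simp) n) fun u hu => ?_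
  have hmeas : MeasurableSet (⋂ n : ℕ, ⋃ k : ℕ, (u (n + k) : Set X)) :=
    MeasurableSet.iInter fun n => MeasurableSet.iUnion fun k => (u (n + k)).2
  refine ⟨toMeasuredSets μ _ hmeas, ?_⟩
  have hsub : ∀ n, (u n : Set X) ∆ (⋂ n : ℕ, ⋃ k : ℕ, (u (n + k) : Set X)) ⊆
      ⋃ k : ℕ, (u (n + k) : Set X) ∆ (u (n + k + 1) : Set X) := by
    intro n x hx
    by_contra hnot
    simp only [Set.mem_iUnion, not_exists] at hnot
    have hiff : ∀ k, x ∈ (u (n + k) : Set X) ↔ x ∈ (u n : Set X) := by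
      intro k
      induction k with
      | zero => rfl
      | succ k ih =>
        rw [← ih]
        have := hnot k
        rw [Set.mem_symmDiff] at this
        rw [← add_assoc]
        tauto
    have hA : x ∈ (⋂ n : ℕ, ⋃ k : ℕ, (u (n + k) : Set X)) ↔ x ∈ (u n : Set X) := by
      simp only [Set.mem_iInter, Set.mem_iUnion]
      constructor
      · intro h
        obtain ⟨k, hk⟩ := h n
        exact (hiff k).1 hk
      · intro h m
        refine ⟨n, ?_⟩
        rw [add_comm]
        exact (hiff m).2 h
    rw [Set.mem_symmDiff] at hx
    tauto
  have hbound : ∀ n, edist (u n) (toMeasuredSets μ _ hmeas) ≤ (2⁻¹ : ℝ≥0∞) ^ n * 2 := by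
    intro n
    calc edist (u n) (toMeasuredSets μ _ hmeas)
        ≤ μ (⋃ k : ℕ, (u (n + k) : Set X) ∆ (u (n + k + 1) : Set X)) := measure_mono (hsub n)
      _ ≤ ∑' k : ℕ, μ ((u (n + k) : Set X) ∆ (u (n + k + 1) : Set X)) := measure_iUnion_le _
      _ ≤ ∑' k : ℕ, (2⁻¹ : ℝ≥0∞) ^ n * (2⁻¹ : ℝ≥0∞) ^ k := by
        refine ENNReal.tsum_le_tsum fun k => ?_
        rw [← pow_add]
        exact (hu (n + k) (n + k) (n + k + 1) le_rfl (Nat.le_succ _)).le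
      _ = (2⁻¹ : ℝ≥0∞) ^ n * 2 := by
        rw [ENNReal.tsum_mul_left, ENNReal.tsum_geometric, ENNReal.one_sub_inv_two, inv_inv]
  rw [tendsto_iff_edist_tendsto_0]
  have hlim : Tendsto (fun n : ℕ => (2⁻¹ : ℝ≥0∞) ^ n * 2) atTop (𝓝 0) := by
    have h := ENNReal.Tendsto.mul_const (b := 2)
      (ENNReal.tendsto_pow_atTop_nhds_zero_of_lt_one ENNReal.one_half_lt_one)
      (Or.inr ENNReal.ofNat_ne_top)
    rwa [zero_mul] at h
  exact tendsto_of_tendsto_of_tendsto_of_le_of_le tendsto_const_nhds hlim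
    (fun _ => zero_le) hbound

/-- Complementation of measurable sets, as a self-homeomorphism of `MeasuredSets μ`. -/
def measuredSetsCompl (μ : Measure X) : MeasuredSets μ ≃ₜ MeasuredSets μ :=
  have hc : Continuous fun A : MeasuredSets μ => toMeasuredSets μ (A : Set X)ᶜ A.2.compl :=
    Isometry.continuous fun A B => by
      rw [MeasuredSets.edist_def, MeasuredSets.edist_def, coe_toMeasuredSets, coe_toMeasuredSets,
        compl_symmDiff_compl]
  { toFun := fun A => toMeasuredSets μ (A : Set X)ᶜ A.2.compl
    invFun := fun A => toMeasuredSets μ (A : Set X)ᶜ A.2.compl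
    left_inv := fun A => Subtype.ext (compl_compl (A : Set X))
    right_inv := fun A => Subtype.ext (compl_compl (A : Set X))
    continuous_toFun := hc
    continuous_invFun := hc }

end MeasuredSetsTopology

/-! ### Upper and lower limits of indicator averages. -/

section Averages

variable {X : Type*} {T : X → X} {A A' : Set X} {x : X}

lemma avgAlong_indicator_nonneg (τ : ℕ → X → X) (A : Set X) (N : ℕ) (x : X) :
    0 ≤ avgAlong τ (A.indicator fun _ => (1 : ℝ)) N x :=
  mul_nonneg (by positivity)
    (Finset.sum_nonneg fun _ _ => Set.indicator_nonneg (fun _ _ => zero_le_one) _)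

lemma avgAlong_indicator_add_compl (τ : ℕ → X → X) (A : Set X) {N : ℕ} (hN : 0 < N) (x : X) :
    avgAlong τ (A.indicator fun _ => (1 : ℝ)) N x +
      avgAlong τ (Aᶜ.indicator fun _ => (1 : ℝ)) N x = 1 := by
  have hN' : (N : ℝ) ≠ 0 := by exact_mod_cast hN.ne'
  simp only [avgAlong]
  rw [← mul_add, ← Finset.sum_add_distrib,
    Finset.sum_congr rfl fun n _ => Set.indicator_self_add_compl_apply A (fun _ => (1 : ℝ)) (τ n x)]
  simp [hN']

lemma avgAlong_indicator_le_one (τ : ℕ → X → X) (A : Set X) (N : ℕ) (x : X) :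
    avgAlong τ (A.indicator fun _ => (1 : ℝ)) N x ≤ 1 := by
  rcases Nat.eq_zero_or_pos N with rfl | hN
  · simp [avgAlong]
  · linarith [avgAlong_indicator_add_compl τ A hN x, avgAlong_indicator_nonneg τ Aᶜ N x]

lemma avgAlong_indicator_mono (τ : ℕ → X → X) (h : A ⊆ A') (N : ℕ) (x : X) :
    avgAlong τ (A.indicator fun _ => (1 : ℝ)) N x ≤
      avgAlong τ (A'.indicator fun _ => (1 : ℝ)) N x := by
  unfold avgAlong
  gcongr

lemma largeAverageSet_mono (h : A ⊆ A') {k k' : ℕ} (hk : k' ≤ k) {δ δ' : ℝ} (hδ : δ ≤ δ') :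
    largeAverageSet T A k δ ⊆ largeAverageSet T A' k' δ' := by
  rintro x ⟨N, hN, hx⟩
  exact ⟨N, hk.trans hN, by linarith [avgAlong_indicator_mono (omegaIterate T) h N x]⟩

lemma limsup_avgAlong_eq_one
    (h : ∀ k : ℕ, x ∈ largeAverageSet T A k (1 / ((k : ℝ) + 1))) :
    limsup (fun N : ℕ => avgAlong (omegaIterate T) (A.indicator fun _ => (1 : ℝ)) N x) atTop
      = 1 := by
  have hbdd : IsBoundedUnder (· ≤ ·) atTop
      fun N : ℕ => avgAlong (omegaIterate T) (A.indicator fun _ => (1 : ℝ)) N x :=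
    isBoundedUnder_of ⟨1, fun N => avgAlong_indicator_le_one _ A N x⟩
  have hbdd' : IsBoundedUnder (· ≥ ·) atTop
      fun N : ℕ => avgAlong (omegaIterate T) (A.indicator fun _ => (1 : ℝ)) N x :=
    isBoundedUnder_of ⟨0, fun N => avgAlong_indicator_nonneg _ A N x⟩
  refine le_antisymm (limsup_le_of_le hbdd'.isCoboundedUnder_le
    (Eventually.of_forall fun N => avgAlong_indicator_le_one _ A N x)) ?_
  refine le_of_forall_pos_le_add fun ε hε => ?_
  rw [← sub_le_iff_le_add]
  obtain ⟨k₀, hk₀⟩ := exists_nat_one_div_lt hε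
  refine le_limsup_of_frequently_le (frequently_atTop.2 fun n => ?_) hbdd
  obtain ⟨N, hN, hx⟩ := largeAverageSet_mono subset_rfl (le_max_left n k₀) le_rfl
    (h (max n k₀))
  refine ⟨N, hN, ?_⟩
  have : 1 / (((max n k₀ : ℕ) : ℝ) + 1) ≤ 1 / ((k₀ : ℝ) + 1) := by
    gcongr
    exact le_max_right _ _
  linarith

lemma liminf_avgAlong_eq_zero
    (h : ∀ k : ℕ, x ∈ largeAverageSet T Aᶜ k (1 / ((k : ℝ) + 1))) :
    liminf (fun N : ℕ => avgAlong (omegaIterate T) (A.indicator fun _ => (1 : ℝ)) N x) atTop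
      = 0 := by
  have hbdd : IsBoundedUnder (· ≤ ·) atTop
      fun N : ℕ => avgAlong (omegaIterate T) (A.indicator fun _ => (1 : ℝ)) N x :=
    isBoundedUnder_of ⟨1, fun N => avgAlong_indicator_le_one _ A N x⟩
  have hbdd' : IsBoundedUnder (· ≥ ·) atTop
      fun N : ℕ => avgAlong (omegaIterate T) (A.indicator fun _ => (1 : ℝ)) N x :=
    isBoundedUnder_of ⟨0, fun N => avgAlong_indicator_nonneg _ A N x⟩
  refine le_antisymm ?_ (le_liminf_of_le hbdd.isCoboundedUnder_ge
    (Eventually.of_forall fun N => avgAlong_indicator_nonneg _ A N x))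
  refine le_of_forall_pos_le_add fun ε hε => ?_
  rw [zero_add]
  obtain ⟨k₀, hk₀⟩ := exists_nat_one_div_lt hε
  refine liminf_le_of_frequently_le (frequently_atTop.2 fun n => ?_) hbdd'
  -- The `n + 1` excludes `N = 0`, where the averages of `A` and `Aᶜ` do not add up to `1`.
  obtain ⟨N, hN, hx⟩ := h (max (n + 1) k₀)
  have hN1 : n + 1 ≤ N := (le_max_left _ _).trans hN
  refine ⟨N, by omega, ?_⟩
  have h1 : 1 / (((max (n + 1) k₀ : ℕ) : ℝ) + 1) ≤ 1 / ((k₀ : ℝ) + 1) := by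
    gcongr
    exact le_max_right _ _
  linarith [avgAlong_indicator_add_compl (omegaIterate T) A (by omega : 0 < N) x]

end Averages

/-! ### Baire category argument. -/

section Genericity

open scoped symmDiff ENNReal

variable {X : Type*} [MeasurableSpace X] {μ : Measure X} {T : X → X}

lemma measurable_avgAlong_indicator (hT : Measurable T) {A : Set X} (hA : MeasurableSet A)
    (N : ℕ) : Measurable (avgAlong (omegaIterate T) (A.indicator fun _ => (1 : ℝ)) N) :=
  (Finset.measurable_sum _ fun n _ =>
    (measurable_const.indicator hA).comp (hT.iterate (Ω n))).const_mul _

/-- Continuity from above reduces to finitely many averages, which is what makes the condition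
stable under perturbing `A`. -/
lemma exists_measure_finite_range_lt [IsFiniteMeasure μ] (hT : Measurable T) {A : Set X}
    (hA : MeasurableSet A) {k : ℕ} {δ : ℝ} {ε : ℝ≥0∞}
    (h : μ (largeAverageSet T A k δ)ᶜ < ε) :
    ∃ K : ℕ, μ {x | ∀ N ∈ Finset.Icc k K,
      avgAlong (omegaIterate T) (A.indicator fun _ => (1 : ℝ)) N x < 1 - δ} < ε := by
  have heq : (largeAverageSet T A k δ)ᶜ = ⋂ K : ℕ, {x | ∀ N ∈ Finset.Icc k K,
      avgAlong (omegaIterate T) (A.indicator fun _ => (1 : ℝ)) N x < 1 - δ} := by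
    ext x
    simp only [largeAverageSet, Set.mem_compl_iff, Set.mem_ofPred_eq, Set.mem_iInter,
      Finset.mem_Icc, not_exists, not_and, not_le]
    exact ⟨fun hx _ N hN => hx N hN.1, fun hx N hN => hx N N ⟨hN, le_rfl⟩⟩
  have hmeas : ∀ K : ℕ, MeasurableSet {x | ∀ N ∈ Finset.Icc k K,
      avgAlong (omegaIterate T) (A.indicator fun _ => (1 : ℝ)) N x < 1 - δ} := by
    intro K
    have : {x | ∀ N ∈ Finset.Icc k K,
        avgAlong (omegaIterate T) (A.indicator fun _ => (1 : ℝ)) N x < 1 - δ} =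
        ⋂ N ∈ Finset.Icc k K,
          {x | avgAlong (omegaIterate T) (A.indicator fun _ => (1 : ℝ)) N x < 1 - δ} := by
      ext x
      simp
    rw [this]
    exact Finset.measurableSet_biInter _ fun N _ =>
      measurableSet_lt (measurable_avgAlong_indicator hT hA N) measurable_const
  have hlim := tendsto_measure_iInter_atTop (μ := μ) (fun K => (hmeas K).nullMeasurableSet)
    (fun K K' hKK' x hx N hN => hx N (Finset.Icc_subset_Icc_right hKK' hN))
    ⟨0, measure_ne_top _ _⟩
  rw [← heq] at hlim
  exact ((tendsto_order.1 hlim).2 _ h).exists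

lemma isOpen_setOf_measure_largeAverageSet_compl_lt [IsFiniteMeasure μ]
    (hT : MeasurePreserving T μ μ) (k : ℕ) (δ : ℝ) (ε : ℝ≥0∞) :
    IsOpen {A : MeasuredSets μ | μ (largeAverageSet T (A : Set X) k δ)ᶜ < ε} := by
  rw [EMetric.isOpen_iff]
  intro A hA
  obtain ⟨K, hK⟩ := exists_measure_finite_range_lt hT.measurable A.2 hA
  set C : Set X → Set X := fun A => {x | ∀ N ∈ Finset.Icc k K,
    avgAlong (omegaIterate T) (A.indicator fun _ => (1 : ℝ)) N x < 1 - δ}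
  obtain ⟨η, hη, hηlt⟩ : ∃ η : ℝ≥0∞, 0 < η ∧ μ (C A) + K * η < ε := by
    have hpos : 0 < (ε - μ (C A)) / (K + 1) :=
      ENNReal.div_pos (tsub_pos_of_lt hK).ne' (by finiteness)
    obtain ⟨η, hη, hlt⟩ := exists_between hpos
    refine ⟨η, hη, ?_⟩
    have h1 : η * (K + 1) < ε - μ (C A) :=
      (ENNReal.lt_div_iff_mul_lt (Or.inl (by simp)) (Or.inl (by finiteness))).1 hlt
    have h2 : (K : ℝ≥0∞) * η < ε - μ (C A) := by
      refine lt_of_le_of_lt ?_ h1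
      rw [mul_comm]
      gcongr
      exact le_self_add
    rw [add_comm]
    exact lt_tsub_iff_right.1 h2
  refine ⟨η, hη, fun A' hA' => ?_⟩
  have hd : μ ((A' : Set X) ∆ A) < η := hA'
  have hmeas : MeasurableSet ((A' : Set X) ∆ A) := A'.2.symmDiff A.2
  -- Off the `K` preimages of `A' ∆ A`, each of measure below `η`, the averages of `A` and `A'` up
  -- to `K` agree.
  have hsub : (largeAverageSet T (A' : Set X) k δ)ᶜ ⊆
      C A ∪ ⋃ n ∈ Finset.Icc 1 K, T^[Ω n] ⁻¹' ((A' : Set X) ∆ A) := by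
    intro x hx
    by_contra hnot
    simp only [Set.mem_union, not_or, Set.mem_iUnion, not_exists] at hnot
    obtain ⟨hxC, hxD⟩ := hnot
    refine hxC fun N hN => ?_
    rw [Finset.mem_Icc] at hN
    have heq : avgAlong (omegaIterate T) ((A : Set X).indicator fun _ => (1 : ℝ)) N x =
        avgAlong (omegaIterate T) ((A' : Set X).indicator fun _ => (1 : ℝ)) N x := by
      unfold avgAlong
      congr 1
      refine Finset.sum_congr rfl fun n hn => ?_
      rw [Finset.mem_Icc] at hn
      have h1 := hxD n (Finset.mem_Icc.2 ⟨hn.1, hn.2.trans hN.2⟩)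
      rw [Set.mem_preimage, Set.mem_symmDiff] at h1
      have h2 : omegaIterate T n x ∈ (A : Set X) ↔ omegaIterate T n x ∈ (A' : Set X) := by
        unfold omegaIterate
        tauto
      by_cases h3 : omegaIterate T n x ∈ (A' : Set X)
      · rw [Set.indicator_of_mem h3, Set.indicator_of_mem (h2.2 h3)]
      · rw [Set.indicator_of_notMem h3, Set.indicator_of_notMem fun h => h3 (h2.1 h)]
    rw [heq]
    by_contra! h
    exact hx ⟨N, hN.1, h⟩
  calc μ (largeAverageSet T (A' : Set X) k δ)ᶜ
      ≤ μ (C A) + ∑ n ∈ Finset.Icc 1 K, μ (T^[Ω n] ⁻¹' ((A' : Set X) ∆ A)) :=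
        (measure_mono hsub).trans ((measure_union_le _ _).trans
          (by gcongr; exact measure_biUnion_finset_le _ _))
    _ = μ (C A) + K * μ ((A' : Set X) ∆ A) := by
      simp only [(hT.iterate _).measure_preimage hmeas.nullMeasurableSet, Finset.sum_const,
        Nat.card_Icc, add_tsub_cancel_right, nsmul_eq_mul]
    _ ≤ μ (C A) + K * η := by gcongr
    _ < ε := hηlt

lemma dense_setOf_measure_largeAverageSet_compl_lt [IsProbabilityMeasure μ] (hT : Ergodic T μ)
    (hsmall : ∀ δ : ℝ, 0 < δ → ∃ F, MeasurableSet F ∧ μ F ≠ 0 ∧ μ.real F ≤ δ)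
    (k : ℕ) {δ : ℝ} (hδ : 0 < δ) :
    Dense {A : MeasuredSets μ |
      μ (largeAverageSet T (A : Set X) k δ)ᶜ < ENNReal.ofReal δ} := by
  intro A
  rw [Metric.mem_closure_iff]
  intro ε hε
  obtain ⟨E, hE, hE1, hE2⟩ := exists_small_set_largeAverageSet hT hsmall
    (by positivity : 0 < min (δ / 2) (ε / 2)) k
  -- Adding `E` can only raise averages, and moves `A` by at most the measure of `E`.
  refine ⟨toMeasuredSets μ ((A : Set X) ∪ E) (A.2.union hE), ?_, ?_⟩
  · change μ (largeAverageSet T ((A : Set X) ∪ E) k δ)ᶜ < ENNReal.ofReal δ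
    rw [ENNReal.lt_ofReal_iff_toReal_lt (measure_ne_top _ _)]
    have h1 : largeAverageSet T E k (min (δ / 2) (ε / 2)) ⊆
        largeAverageSet T ((A : Set X) ∪ E) k δ :=
      largeAverageSet_mono Set.subset_union_right le_rfl ((min_le_left _ _).trans (by linarith))
    have h2 := measureReal_mono (μ := μ) (Set.compl_subset_compl.2 h1)
    rw [measureReal_def] at h2
    linarith [min_le_left (δ / 2) (ε / 2)]
  · rw [MeasuredSets.dist_def]
    have h1 : (A : Set X) ∆ ((A : Set X) ∪ E) ⊆ E := by
      intro x hx
      rw [Set.mem_symmDiff, Set.mem_union] at hx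
      tauto
    exact (measureReal_mono h1).trans_lt (by linarith [min_le_right (δ / 2) (ε / 2)])

lemma ae_forall_mem_largeAverageSet [IsFiniteMeasure μ] {A : Set X}
    (h : ∀ k : ℕ, μ (largeAverageSet T A k (1 / ((k : ℝ) + 1)))ᶜ <
      ENNReal.ofReal (1 / ((k : ℝ) + 1))) :
    ∀ᵐ x ∂μ, ∀ k : ℕ, x ∈ largeAverageSet T A k (1 / ((k : ℝ) + 1)) := by
  rw [ae_all_iff]
  intro k
  rw [ae_iff]
  refine le_antisymm ?_ zero_le
  have hlim : Tendsto (fun n : ℕ => ENNReal.ofReal (1 / ((n : ℝ) + 1))) atTop (𝓝 0) := by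
    have := ENNReal.tendsto_ofReal (tendsto_one_div_add_atTop_nhds_zero_nat (𝕜 := ℝ))
    rwa [ENNReal.ofReal_zero] at this
  -- The conditions strengthen with the index, so the exceptional set for `k` lies in that for every
  -- `n ≥ k`, of measure below `1 / (n + 1)`; no Borel–Cantelli argument is needed.
  refine ge_of_tendsto hlim (eventually_atTop.2 ⟨k, fun n hn => ?_⟩)
  refine le_trans (measure_mono (Set.compl_subset_compl.2 ?_)) (h n).le
  refine largeAverageSet_mono subset_rfl hn ?_
  gcongr

lemma strongSweepingOut_omegaIterate [IsProbabilityMeasure μ] (hT : Ergodic T μ)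
    (hsmall : ∀ δ : ℝ, 0 < δ → ∃ F, MeasurableSet F ∧ μ F ≠ 0 ∧ μ.real F ≤ δ) :
    StrongSweepingOut μ (omegaIterate T) := by
  set U : ℕ → Set (MeasuredSets μ) := fun k =>
    {A | μ (largeAverageSet T (A : Set X) k (1 / ((k : ℝ) + 1)))ᶜ <
      ENNReal.ofReal (1 / ((k : ℝ) + 1))}
  have hUo : ∀ k, IsOpen (U k) := fun k =>
    isOpen_setOf_measure_largeAverageSet_compl_lt hT.toMeasurePreserving k _ _
  have hUd : ∀ k, Dense (U k) := fun k =>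
    dense_setOf_measure_largeAverageSet_compl_lt hT hsmall k (by positivity)
  have hVo : ∀ k, IsOpen (measuredSetsCompl μ ⁻¹' U k) := fun k =>
    (hUo k).preimage (measuredSetsCompl μ).continuous
  have hVd : ∀ k, Dense (measuredSetsCompl μ ⁻¹' U k) := fun k =>
    (hUd k).preimage (measuredSetsCompl μ).isOpenMap
  refine ⟨⋂ k, U k ∩ measuredSetsCompl μ ⁻¹' U k,
    IsGδ.iInter fun k => ((hUo k).inter (hVo k)).isGδ,
    dense_iInter_of_isOpen_nat (fun k => (hUo k).inter (hVo k))
      fun k => (hUd k).inter_of_isOpen_left (hVd k) (hUo k), fun A hA => ?_⟩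
  rw [Set.mem_iInter] at hA
  filter_upwards [ae_forall_mem_largeAverageSet fun k => (hA k).1,
    ae_forall_mem_largeAverageSet fun k => (hA k).2] with x h1 h2
  exact ⟨limsup_avgAlong_eq_one h1, liminf_avgAlong_eq_zero h2⟩

lemma StrongSweepingOut.exists_sweepsOut {τ : ℕ → X → X} (h : StrongSweepingOut μ τ) :
    ∃ A : Set X, MeasurableSet A ∧ SweepsOut μ τ A := by
  obtain ⟨R, -, hR, h⟩ := h
  obtain ⟨A, hA⟩ := hR.nonempty (h := ⟨⟨∅, MeasurableSet.empty⟩⟩)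
  exact ⟨A, A.2, h A hA⟩

lemma SweepsOut.ae_not_tendsto {τ : ℕ → X → X} {A : Set X} (h : SweepsOut μ τ A) :
    ∀ᵐ x ∂μ, ¬ ∃ c : ℝ, Tendsto
      (fun N : ℕ => avgAlong τ (A.indicator fun _ => (1 : ℝ)) N x) atTop (𝓝 c) := by
  filter_upwards [h] with x ⟨h1, h2⟩ ⟨c, hc⟩
  rw [hc.limsup_eq] at h1
  rw [hc.liminf_eq] at h2
  linarith

end Genericity

theorem theorem1p2 {X : Type*} [MetricSpace X] [CompactSpace X] [MeasurableSpace X] [BorelSpace X]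
    (μ : Measure X) [IsProbabilityMeasure μ] [NullSingletonClass μ] (T : X → X) (hT : Ergodic T μ) :
    (∃ A : Set X, MeasurableSet A ∧ SweepsOut μ (omegaIterate T) A) ∧
    StrongSweepingOut μ (omegaIterate T) ∧
    (∃ f : X → ℝ, Integrable f μ ∧
      ∀ᵐ x ∂μ, ¬ ∃ c : ℝ, Tendsto (fun N : ℕ => avgAlong (omegaIterate T) f N x) atTop (𝓝 c)) := by
  have h := strongSweepingOut_omegaIterate hT (exists_measurableSet_small_measure μ)
  obtain ⟨A, hA, hsweep⟩ := h.exists_sweepsOut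
  exact ⟨⟨A, hA, hsweep⟩, h, A.indicator fun _ => (1 : ℝ),
    (integrable_const 1).indicator hA, hsweep.ae_not_tendsto⟩
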